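/- Let $A\in\mathbb R^{m\times n}$ with $\operatorname{rank}(A)=m$, $b\in\mathbb R^m$, and $c\in\mathbb R^n$ with $\|c\|_2=1$. Suppose that the linear program $$P:\ \min\{c^Tx \mid Ax=b,\ x\ge 0\}$$ is feasible and bounded. Let $[n]=\{1,\dots,n\}$ be the disjoint union of groups $\mathcal G_1,\dots,\mathcal G_{n_{\mathcal G}}$, and for each $g$ let $\xi^g$ be a probability distribution on $\mathcal G_g$. Sample $K=n_r n_{\mathcal G}$ indices $j_1,\dots,j_K\in[n]$ in $n_r\ge 1$ independent rounds. In each round, for $i=1,\dots,n_{\mathcal G}$, choose a group index $g_i$ uniformly at random from $[n_{\mathcal G}]\setminus\{g_1,\dots,g_{i-1}\}$ and then sample an index from $\mathcal G_{g_i}$ according to $\xi^{g_i}$. Each sampled index then has the distribution $\xi$ on $[n]$ given by $\xi_t=\frac1{n_{\mathcal G}}\xi^{g}_t$ for $t\in\mathcal G_g$. Write $J$ for the sample, $A_J=[A_{j_1},\dots,A_{j_K}]$ for the matrix of sampled columns of $A$, and $c_J=(c_{j_1},\dots,c_{j_K})^T$. Let $$P_J:\ \min\{c_J^Ty\mid A_Jy=b,\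 y\ge0\},$$ and, for a constant $C\ge0$, let $$P_{\rm distr}:\ \min\{c^Tx\mid Ax=b,\ 0\le x\le C\xi\}.$$ Let $v(\cdot)$ denote the optimal value of a linear program ($+\infty$ if it is infeasible), and put $\Delta v(\cdot)=v(\cdot)-v(P)$. A basis is a set $B\subseteq[n]$ of $m$ indices such that the submatrix $A_B$ of the columns indexed by $B$ is nonsingular. Its dual basic solution is $p^T=c_B^TA_B^{-1}$, and its reduced cost vector is $\bar c=c^T-c_B^TA_B^{-1}A$. Let $\gamma$ be an upper bound on $\|p\|_\infty$ for the dual basic solutions $p$ of all bases, let $\chi$ be an upper bound on $\|\bar c\|_2$ for the reduced cost vectors of all bases, and let $\|A\|_{\max}=\max_{i,j}|A_{ij}|$. Then for every $\delta\in(0,1)$: 1. With probability at least $1-\delta$ over the sample, the following holds: if $P_J$ is feasible and $\operatorname{rank}(A_J)=m$, then $$\Delta v(P_J)\le\Delta v(P_{\rm distr})+\frac{C\,(1+m\gamma\|A\|_{\max})}{\sqrt{n_r}}\left(1+\sqrt{2\log\tfrac2\delta}\right).$$ 2. With probability at least $1-\delta$ over the sample, the following holds: if $P_J$ is feasible and $\operatorname{rank}(A_J)=m$,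 then $$\Delta v(P_J)\le\Delta v(P_{\rm distr})+\frac{C\,\chi}{\sqrt{n_r}}\left(1+\sqrt{2\log\tfrac1\delta}\right).$$ -/

import Mathlib

open Matrix MeasureTheory

noncomputable section

namespace ColumnSampling

/-- Feasible region `{x | A x = b, x ≥ 0}` of a linear program in standard form. -/
def stdFeasible {m : ℕ} {ι : Type*} [Fintype ι] (A : Matrix (Fin m) ι ℝ) (b : Fin m → ℝ) :
    Set (ι → ℝ) :=
  {x | A *ᵥ x = b ∧ 0 ≤ x}

/-- Feasible region `{x | A x = b, 0 ≤ x ≤ C ξ}` of the distributional counterpart. -/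
def distrFeasible {m n : ℕ} (A : Matrix (Fin m) (Fin n) ℝ) (b : Fin m → ℝ) (C : ℝ)
    (ξ : Fin n → ℝ) : Set (Fin n → ℝ) :=
  {x | A *ᵥ x = b ∧ 0 ≤ x ∧ x ≤ C • ξ}

/-- Optimal value of `min {cᵀx | x ∈ F}`, an extended real number; it is `+∞` if `F` is empty. -/
def optValue {ι : Type*} [Fintype ι] (c : ι → ℝ) (F : Set (ι → ℝ)) : EReal :=
  ⨅ x ∈ F, ((c ⬝ᵥ x : ℝ) : EReal)

/-- The matrix `[A_{B 1}, …, A_{B k}]` of the columns of `A` listed by `B`. -/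
def cols {m n : ℕ} {κ : Type*} (A : Matrix (Fin m) (Fin n) ℝ) (B : κ → Fin n) :
    Matrix (Fin m) κ ℝ :=
  A.submatrix id B

/-- `B` lists the elements of a basis: the `m × m` matrix `A_B` is nonsingular
(in particular the `m` indices listed are distinct). -/
def IsBasis {m n : ℕ} (A : Matrix (Fin m) (Fin n) ℝ) (B : Fin m → Fin n) : Prop :=
  IsUnit (cols A B).det

/-- The dual basic solution `pᵀ = c_Bᵀ A_B⁻¹` of a basis (it does not depend on the order in
which `B` lists the basis). -/
def dualBasicSol {m n : ℕ} (A : Matrix (Fin m) (Fin n) ℝ) (c : Fin n → ℝ) (B : Fin m → Fin n) :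
    Fin m → ℝ :=
  (c ∘ B) ᵥ* (cols A B)⁻¹

/-- The reduced cost vector `cᵀ - c_Bᵀ A_B⁻¹ A` of a basis. -/
def reducedCost {m n : ℕ} (A : Matrix (Fin m) (Fin n) ℝ) (c : Fin n → ℝ) (B : Fin m → Fin n) :
    Fin n → ℝ :=
  c - dualBasicSol A c B ᵥ* A

/-- The Euclidean norm of a vector. -/
def l2norm {n : ℕ} (v : Fin n → ℝ) : ℝ := Real.sqrt (∑ j, v j ^ 2)

/-- The maximum norm `max |v_i|` of a vector (`0` for the empty vector). -/
def linfNorm {m : ℕ} (v : Fin m → ℝ) : ℝ := ⨆ i, |v i|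

/-- `‖A‖_max = max |A_{ij}|` (`0` for the empty matrix). -/
def maxNorm {m n : ℕ} (A : Matrix (Fin m) (Fin n) ℝ) : ℝ := ⨆ i, ⨆ j, |A i j|

/-- The data of a groupwise randomization scheme: a partition of the column indices into the
groups `{t | group t = g}`, and for each group a probability distribution on it. -/
structure GroupScheme (n nG : ℕ) where
  /-- The group that a column belongs to. -/
  group : Fin n → Fin nG
  /-- The distribution used to sample a column from a group. -/
  dist : Fin nG → PMF (Fin n)
  /-- The distribution of a group lives on that group. -/
  dist_eq_zero : ∀ g t, group t ≠ g → dist g t = 0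

namespace GroupScheme

variable {n nG : ℕ} (S : GroupScheme n nG)

/-- The law of the indices drawn in the last `k` steps of a round, when `R` is the set of the
`k` groups not yet chosen in this round: choose a group `g` uniformly from `R`, draw an index
from the distribution of `g`, and go on with `R \ {g}`. -/
def drawFrom : (k : ℕ) → (R : Finset (Fin nG)) → R.card = k → PMF (Fin k → Fin n)
  | 0, _, _ => PMF.pure Fin.elim0
  | k + 1, R, h =>
    haveI : Nonempty R := (Finset.card_pos.mp (h ▸ Nat.succ_pos k)).to_subtype
    (PMF.uniformOfFintype R).bind fun g =>
      (S.dist g).bind fun t =>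
        (drawFrom k (R.erase g) (by rw [Finset.card_erase_of_mem g.2, h]; rfl)).map
          fun s => Fin.cons t s

/-- The law of the `nG` indices drawn in one round. -/
def roundLaw : PMF (Fin nG → Fin n) :=
  S.drawFrom nG Finset.univ (Finset.card_fin nG)

/-- The law of the sample: `nr` independent rounds, `ω r i` being the `i`-th index of round `r`. -/
def sampleLaw (nr : ℕ) : Measure (Fin nr → Fin nG → Fin n) :=
  Measure.pi fun _ => S.roundLaw.toMeasure

/-- The distribution of a single sampled index, `ξ_t = (1 / nG) ξ^{g}_t` with `g` the group
of `t` (see `sampleLaw_marginal`). -/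
def xi (t : Fin n) : ℝ := 1 / (nG : ℝ) * (S.dist (S.group t) t).toReal

theorem drawFrom_marginal (k : ℕ) (R : Finset (Fin nG)) (h : R.card = k) (i : Fin k)
    (t : Fin n) :
    ((S.drawFrom k R h).map (fun s => s i)) t = (k : ENNReal)⁻¹ * ∑ g ∈ R, S.dist g t := by
  induction k generalizing R with
  | zero => exact i.elim0
  | succ k ih =>
    have hcard : Fintype.card R = k + 1 := by simpa using h
    rw [drawFrom]
    simp only [PMF.map_bind, PMF.map_comp]
    rw [PMF.bind_apply]
    simp only [PMF.uniformOfFintype_apply, hcard, PMF.bind_apply]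
    rw [ENNReal.tsum_mul_left]
    congr 1
    rw [tsum_fintype]
    refine Fin.cases ?_ (fun i => ?_) i
    · have h0 : ∀ g : R, (∑' a, S.dist g a * (((S.drawFrom k (R.erase g)
          (by rw [Finset.card_erase_of_mem g.2, h]; rfl)).map
          ((fun s : Fin (k + 1) → Fin n => s 0) ∘ fun s => Fin.cons a s)) t)) = S.dist g t := by
        intro g
        have : ∀ a : Fin n, ((fun s : Fin (k + 1) → Fin n => s 0) ∘
            fun s : Fin k → Fin n => (Fin.cons a s : Fin (k + 1) → Fin n)) =
            Function.const _ a := by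
          intro a; funext s; simp
        simp only [this, PMF.map_const, PMF.pure_apply]
        rw [tsum_eq_single t]
        · simp
        · intro b hb; simp [hb.symm]
      rw [Finset.sum_congr rfl fun g _ => h0 g]
      exact Finset.sum_coe_sort R fun g => S.dist g t
    · have h1 : ∀ g : R, (∑' a, S.dist g a * (((S.drawFrom k (R.erase g)
          (by rw [Finset.card_erase_of_mem g.2, h]; rfl)).map
          ((fun s : Fin (k + 1) → Fin n => s i.succ) ∘ fun s => Fin.cons a s)) t)) =
          (k : ENNReal)⁻¹ * ∑ g' ∈ R.erase g, S.dist g' t := by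
        intro g
        have : ∀ a : Fin n, ((fun s : Fin (k + 1) → Fin n => s i.succ) ∘
            fun s : Fin k → Fin n => (Fin.cons a s : Fin (k + 1) → Fin n)) =
            fun s => s i := by
          intro a; funext s; simp
        simp only [this, ih]
        rw [ENNReal.tsum_mul_right, PMF.tsum_coe, one_mul]
      rw [Finset.sum_congr rfl fun g _ => h1 g, ← Finset.mul_sum]
      rw [Finset.sum_coe_sort R fun g => ∑ g' ∈ R.erase g, S.dist g' t]
      have h2 : ∑ g ∈ R, ∑ g' ∈ R.erase g, S.dist g' t = (k : ENNReal) * ∑ g ∈ R, S.dist g t := by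
        rw [Finset.sum_comm' (s' := fun g' => R.erase g') (t' := R)]
        · rw [Finset.mul_sum]
          refine Finset.sum_congr rfl fun g hg => ?_
          rw [Finset.sum_const, Finset.card_erase_of_mem hg, h]
          simp
        · intro a b
          simp only [Finset.mem_erase]
          tauto
      rw [h2, ← mul_assoc, ENNReal.inv_mul_cancel, one_mul]
      · have := i.pos
        exact_mod_cast this.ne'
      · exact ENNReal.natCast_ne_top k

/-- Every sampled index has the distribution `ξ`. -/
theorem sampleLaw_marginal (nr : ℕ) (r : Fin nr) (i : Fin nG) (t : Fin n) :
    (S.sampleLaw nr).real {ω | ω r i = t} = S.xi t := by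
  have h1 : {ω : Fin nr → Fin nG → Fin n | ω r i = t} =
      Function.eval r ⁻¹' {s | s i = t} := rfl
  have h2 : (S.sampleLaw nr) {ω | ω r i = t} = S.roundLaw.toMeasure {s | s i = t} := by
    rw [h1, sampleLaw]
    exact (measurePreserving_eval (fun _ : Fin nr => S.roundLaw.toMeasure) r).measure_preimage
      (Set.toFinite _).measurableSet.nullMeasurableSet
  have h3 : S.roundLaw.toMeasure {s | s i = t} = (S.roundLaw.map fun s => s i) t := by
    have hs : {s : Fin nG → Fin n | s i = t} = (fun s => s i) ⁻¹' {t} := rfl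
    rw [hs, ← PMF.toMeasure_map_apply _ _ _ (measurable_pi_apply i) (measurableSet_singleton t),
      PMF.toMeasure_apply_singleton _ _ (measurableSet_singleton t)]
  rw [measureReal_def, h2, h3, roundLaw, drawFrom_marginal, xi,
    Finset.sum_eq_single (S.group t) (fun g _ hg => S.dist_eq_zero g t hg.symm) (by simp)]
  simp

end GroupScheme

/-- All the sampled indices `j_1, …, j_K`, `K = nr * nG`, listed as one family. -/
def indices {n nG nr : ℕ} (ω : Fin nr → Fin nG → Fin n) : Fin nr × Fin nG → Fin n :=
  fun k => ω k.1 k.2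

/-- The optimality gap `Δv = v(P'') - v(P)` of a linear program with optimal value `v`, relative
to the complete problem `P : min {cᵀx | A x = b, x ≥ 0}`. -/
def gap {m n : ℕ} (A : Matrix (Fin m) (Fin n) ℝ) (b : Fin m → ℝ) (c : Fin n → ℝ) (v : EReal) :
    EReal :=
  v - optValue c (stdFeasible A b)

/-- Feasible region of the column-randomized problem
`P_J : min {c_Jᵀ y | A_J y = b, y ≥ 0}`, with one column for each sampled index. -/
def sampledFeasible {m n : ℕ} {κ : Type*} [Fintype κ] (A : Matrix (Fin m) (Fin n) ℝ)
    (b : Fin m → ℝ) (J : κ → Fin n) : Set (κ → ℝ) :=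
  stdFeasible (cols A J) b

/-- If `P_J` is feasible and `rank A_J = m`, then `Δv(P_J) ≤ Δv(P_distr) + ε`. -/
def GapBound {m n : ℕ} {κ : Type*} [Fintype κ] (A : Matrix (Fin m) (Fin n) ℝ) (b : Fin m → ℝ)
    (c : Fin n → ℝ) (C : ℝ) (ξ : Fin n → ℝ) (ε : ℝ) (J : κ → Fin n) : Prop :=
  (sampledFeasible A b J).Nonempty → (cols A J).rank = m →
    gap A b c (optValue (c ∘ J) (sampledFeasible A b J)) ≤
      gap A b c (optValue c (distrFeasible A b C ξ)) + (ε : EReal)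

end ColumnSampling

end

/-! Let `x` be optimal for `P_distr` and write `x = w ξ` with a density `0 ≤ w ≤ C`. Giving each
sampled column `j` the weight `w j / K` yields a nonnegative vector supported on the sample, `push
(indices ω) (sampleWeight w ω)`, whose mean is `x`. It need not be feasible for `P_J`; duality
absorbs the violation. An optimal dual basic solution `p` of `P_J` belongs to a basis of `A` whose
reduced costs are nonnegative on the sampled columns. Hence `v(P_J) ≤ cᵀx + c̄ d`, where `d` is the
sampling error (`exists_optValue_sampled_le`). The basis depends on the sample, but the bounds on
`c̄ d` use only norms of `d` and `A d` and so hold for all bases at once.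

Indices within a round are dependent, so a whole round counts as one draw: its average is a vector
of bounded norm, and the `nr` rounds are independent. `iidMean_norm_sum_gt_le` bounds the norm of
the centered sum: its mean by a variance computation, its deviation from the mean by a martingale
argument with Hoeffding's lemma. The second bound follows by Cauchy–Schwarz. The first splits `c̄ d
= cᵀd - pᵀ(A d)` and takes a union bound over the two norms. -/

noncomputable section

namespace ColumnSampling

/-! ### Linear programming duality and optimal bases -/

/-- **Farkas' lemma** for finitely many linear functionals on an arbitrary real vector space. -/
theorem farkas {W κ : Type*} [AddCommGroup W] [Module ℝ W] (s : Finset κ) (a : κ → W →ₗ[ℝ] ℝ)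
    (β : W →ₗ[ℝ] ℝ) (h : ∀ x, (∀ k ∈ s, a k x ≤ 0) → β x ≤ 0) :
    ∃ l : κ → ℝ, 0 ≤ l ∧ β = ∑ k ∈ s, l k • a k := by
  classical
  induction s using Finset.induction_on generalizing a β with
  | empty =>
    refine ⟨0, le_rfl, LinearMap.ext fun x => ?_⟩
    have h1 := h x (by simp)
    have h2 := h (-x) (by simp)
    simp only [map_neg] at h2
    simp; linarith
  | insert i s hi ih =>
    by_cases hs : ∀ x, (∀ k ∈ s, a k x ≤ 0) → β x ≤ 0
    · obtain ⟨l, hl, e⟩ := ih a β hs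
      refine ⟨Function.update l i 0, fun k => ?_, ?_⟩
      · by_cases hk : k = i
        · subst hk; simp
        · simpa [hk] using hl k
      · rw [Finset.sum_insert hi, e]
        simp only [Function.update_self, zero_smul, zero_add]
        refine Finset.sum_congr rfl fun k hk => ?_
        rw [Function.update_of_ne (ne_of_mem_of_not_mem hk hi)]
    -- Here constraint `i` is needed. A scaled violating point `u` has `a i u = 1`, so `x ↦ x - a i
    -- x • u` projects onto the kernel of `a i`; the induction hypothesis is applied to the
    -- functionals composed with this projection.
    · push Not at hs
      obtain ⟨z, hz, hβz⟩ := hs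
      have hiz : 0 < a i z := by
        by_contra hc
        refine absurd (h z fun k hk => ?_) (not_le.2 hβz)
        rcases Finset.mem_insert.1 hk with rfl | hk
        · exact not_lt.1 hc
        · exact hz k hk
      set u : W := (a i z)⁻¹ • z with hu
      have hiu : a i u = 1 := by simp [hu, hiz.ne']
      have hku : ∀ k ∈ s, a k u ≤ 0 := fun k hk => by
        simpa [hu] using mul_nonpos_of_nonneg_of_nonpos (inv_nonneg.2 hiz.le) (hz k hk)
      have hβu : 0 ≤ β u := by
        simpa [hu] using mul_nonneg (inv_nonneg.2 hiz.le) hβz.le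
      obtain ⟨l, hl, e⟩ := ih (fun k => a k - a k u • a i) (β - β u • a i) (by
        intro x hx
        have := h (x - a i x • u) (by
          intro k hk
          rcases Finset.mem_insert.1 hk with rfl | hk
          · simp [hiu]
          · have := hx k hk
            simp only [LinearMap.sub_apply, LinearMap.smul_apply, smul_eq_mul] at this
            simp only [map_sub, map_smul, smul_eq_mul]
            linarith [mul_comm (a k u) (a i x)])
        simp only [map_sub, map_smul, smul_eq_mul] at this
        simp only [LinearMap.sub_apply, LinearMap.smul_apply, smul_eq_mul]
        linarith [mul_comm (β u) (a i x)])
      -- Undoing the projection leaves exactly this coefficient on `a i`.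
      have hr : 0 ≤ β u - ∑ k ∈ s, l k * a k u := by
        have : ∑ k ∈ s, l k * a k u ≤ 0 :=
          Finset.sum_nonpos fun k hk => mul_nonpos_of_nonneg_of_nonpos (hl k) (hku k hk)
        linarith
      refine ⟨Function.update l i (β u - ∑ k ∈ s, l k * a k u), fun k => ?_, ?_⟩
      · by_cases hk : k = i
        · subst hk; simpa using hr
        · simpa [hk] using hl k
      · rw [Finset.sum_insert hi]
        have h1 : ∑ k ∈ s, Function.update l i (β u - ∑ k ∈ s, l k * a k u) k • a k =
            ∑ k ∈ s, l k • a k := by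
          refine Finset.sum_congr rfl fun k hk => ?_
          rw [Function.update_of_ne (ne_of_mem_of_not_mem hk hi)]
        rw [h1, Function.update_self]
        have h2 := sub_eq_iff_eq_add.1 e
        refine h2.trans ?_
        refine LinearMap.ext fun x => ?_
        simp only [LinearMap.add_apply, LinearMap.sum_apply, LinearMap.sub_apply,
          LinearMap.smul_apply, smul_eq_mul, mul_sub, Finset.sum_sub_distrib, sub_mul,
          Finset.sum_mul, mul_assoc]
        ring

/-- Strong duality: a feasible linear program whose objective is bounded below by `v` has a dual
feasible solution of value at least `v`. -/
theorem exists_dual_feasible {m : ℕ} {κ : Type*} [Fintype κ] (A : Matrix (Fin m) κ ℝ)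
    (b : Fin m → ℝ) (c : κ → ℝ) (v : ℝ) (hne : (stdFeasible A b).Nonempty)
    (hv : ∀ y ∈ stdFeasible A b, v ≤ c ⬝ᵥ y) :
    ∃ p : Fin m → ℝ, p ᵥ* A ≤ c ∧ v ≤ p ⬝ᵥ b := by
  by_contra! hcon
  let P : (Fin m → ℝ) → ((Fin m → ℝ) × ℝ →ₗ[ℝ] ℝ) := fun z =>
    { toFun := fun x => x.1 ⬝ᵥ z
      map_add' := fun x y => by simp [add_dotProduct]
      map_smul' := fun r x => by simp [smul_dotProduct] }
  let σ : (Fin m → ℝ) × ℝ →ₗ[ℝ] ℝ := LinearMap.snd ℝ _ _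
  let a : Option κ → ((Fin m → ℝ) × ℝ →ₗ[ℝ] ℝ) := fun o =>
    o.elim (v • σ - P b) fun k => P (fun i => A i k) - c k • σ
  -- Homogenization: `s * v ≤ p ⬝ᵥ b` and `p ᵥ* A ≤ s • c` force `s ≤ 0`, since otherwise `s⁻¹ • p`
  -- would be the dual solution assumed not to exist. The multipliers form a vector `y ≥ 0` with `A
  -- y = l₀ b` and `cᵀy = l₀ v - 1`, where `l₀ = l none`.
  obtain ⟨l, hl, e⟩ := farkas Finset.univ a σ (by
    rintro ⟨p, s⟩ hx
    by_contra! hs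
    have hs : 0 < s := hs
    have h0 : s * v ≤ p ⬝ᵥ b := by
      have := hx none (Finset.mem_univ _)
      simp [a, P, σ] at this
      linarith
    have hk : ∀ k, (p ᵥ* A) k ≤ s * c k := fun k => by
      have := hx (some k) (Finset.mem_univ _)
      simp [a, P, σ] at this
      simp only [vecMul]
      linarith
    refine absurd (hcon (s⁻¹ • p) fun k => ?_) (not_lt.2 ?_)
    · rw [smul_vecMul, Pi.smul_apply, smul_eq_mul, inv_mul_le_iff₀ hs]; exact hk k
    · rw [smul_dotProduct, smul_eq_mul, le_inv_mul_iff₀ hs]; exact h0)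
  rw [Fintype.sum_option] at e
  set y : κ → ℝ := fun k => l (some k) with hy
  have hy0 : 0 ≤ y := fun k => hl _
  have e1 : A *ᵥ y = l none • b := by
    refine dotProduct_eq _ _ fun p => ?_
    have := LinearMap.congr_fun e (p, 0)
    simp [a, P, σ] at this
    rw [dotProduct_comm, dotProduct_comm _ p, dotProduct_mulVec, dotProduct_smul, smul_eq_mul]
    simp only [dotProduct, vecMul, hy] at this ⊢
    simp only [mul_comm (l (some _))] at this
    linarith
  have e2 : l none * v - c ⬝ᵥ y = 1 := by
    have := LinearMap.congr_fun e (0, 1)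
    simp [a, P, σ] at this
    simp only [dotProduct, hy, mul_comm (c _)]
    linarith
  obtain ⟨y0, hA0, h00⟩ := hne
  -- If `l₀ = 0`, then `y` is a recession direction of cost `-1`, so the primal is unbounded; if `l₀
  -- > 0`, then `y / l₀` is feasible with cost below `v`.
  rcases (hl none).eq_or_lt with h0 | h0
  · simp only [Pi.zero_apply] at h0
    rw [← h0] at e1 e2
    have h3 : ∀ t : ℝ, 0 ≤ t → v ≤ c ⬝ᵥ y0 - t := fun t ht => by
      have := hv (y0 + t • y) ⟨by rw [mulVec_add, mulVec_smul, e1, hA0]; simp,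
        add_nonneg h00 (smul_nonneg ht hy0)⟩
      rw [dotProduct_add, dotProduct_smul, smul_eq_mul] at this
      nlinarith
    have h4 := h3 (|c ⬝ᵥ y0 - v| + 1) (by positivity)
    linarith [le_abs_self (c ⬝ᵥ y0 - v)]
  · simp only [Pi.zero_apply] at h0
    have := hv ((l none)⁻¹ • y) ⟨by rw [mulVec_smul, e1, smul_smul, inv_mul_cancel₀ h0.ne',
      one_smul], smul_nonneg (inv_nonneg.2 h0.le) hy0⟩
    rw [dotProduct_smul, smul_eq_mul, le_inv_mul_iff₀ h0] at this
    linarith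

/-- A dual feasible solution can be moved to one whose tight constraints span, without decreasing
its value. -/
theorem exists_dual_vertex {m : ℕ} {κ : Type*} [Fintype κ] (A : Matrix (Fin m) κ ℝ)
    (b : Fin m → ℝ) (c : κ → ℝ) (v : ℝ) (hne : (stdFeasible A b).Nonempty)
    (hspan : Submodule.span ℝ (Set.range A.col) = ⊤)
    (hp : ∃ p : Fin m → ℝ, p ᵥ* A ≤ c ∧ v ≤ p ⬝ᵥ b) :
    ∃ p : Fin m → ℝ, p ᵥ* A ≤ c ∧ v ≤ p ⬝ᵥ b ∧
      Submodule.span ℝ (A.col '' {k | (p ᵥ* A) k = c k}) = ⊤ := by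
  classical
  obtain ⟨y, hAy, hy⟩ := hne
  -- Among the candidates, `p` has the fewest slack constraints; a move that keeps the tight ones
  -- and gains another is then a contradiction.
  obtain ⟨p, ⟨hpc, hpv⟩, hmin⟩ := (measure fun p : Fin m → ℝ =>
    (Finset.univ.filter fun k => (p ᵥ* A) k ≠ c k).card).wf.has_min
      {p | p ᵥ* A ≤ c ∧ v ≤ p ⬝ᵥ b} hp
  refine ⟨p, hpc, hpv, ?_⟩
  by_contra hT
  -- a direction along which the value does not decrease and which leaves tight constraints tight
  obtain ⟨d, hd0, hdT, hdb⟩ : ∃ d : Fin m → ℝ, d ≠ 0 ∧ (∀ k, (p ᵥ* A) k = c k → (d ᵥ* A) k = 0) ∧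
      0 ≤ d ⬝ᵥ b := by
    obtain ⟨f, hf, hle⟩ := Submodule.exists_le_ker_of_lt_top _ (lt_top_iff_ne_top.2 hT)
    set d : Fin m → ℝ := fun i => f (Pi.single i 1) with hd
    have hfd : ∀ z, f z = d ⬝ᵥ z := fun z => by
      conv_lhs => rw [pi_eq_sum_univ' z]
      simp [dotProduct, hd, mul_comm]
    have hd0 : d ≠ 0 := fun h => hf (LinearMap.ext fun z => by rw [hfd, h]; simp)
    have hdT : ∀ k, (p ᵥ* A) k = c k → (d ᵥ* A) k = 0 := fun k hk => by
      have := hle (Submodule.subset_span ⟨k, hk, rfl⟩)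
      rw [LinearMap.mem_ker, hfd] at this
      exact this
    rcases le_total 0 (d ⬝ᵥ b) with h | h
    · exact ⟨d, hd0, hdT, h⟩
    · exact ⟨-d, neg_ne_zero.2 hd0, fun k hk => by simp [neg_vecMul, hdT k hk],
        by rw [neg_dotProduct]; linarith⟩
  -- The move must hit a constraint. If `d ᵥ* A ≤ 0`, a primal feasible point shows `d ⬝ᵥ b ≤ 0`, so
  -- `-d` serves as well; it is blocked because `d ᵥ* A = 0` is impossible when the columns span.
  have hblock : ∃ d : Fin m → ℝ, (∀ k, (p ᵥ* A) k = c k → (d ᵥ* A) k = 0) ∧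
      0 ≤ d ⬝ᵥ b ∧ ∃ k, 0 < (d ᵥ* A) k := by
    by_cases h : ∃ k, 0 < (d ᵥ* A) k
    · exact ⟨d, hdT, hdb, h⟩
    push Not at h
    have hdb' : d ⬝ᵥ b ≤ 0 := by
      rw [← hAy, dotProduct_mulVec]
      exact Finset.sum_nonpos fun k _ => mul_nonpos_of_nonpos_of_nonneg (h k) (hy k)
    refine ⟨-d, fun k hk => by simp [neg_vecMul, hdT k hk],
        by rw [neg_dotProduct]; linarith, ?_⟩
    by_contra! h'
    have hz : ∀ k, d ⬝ᵥ A.col k = 0 := fun k => by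
      have h1 := h' k
      rw [neg_vecMul, Pi.neg_apply] at h1
      exact le_antisymm (h k) (neg_nonpos.1 h1)
    have hall : ∀ x ∈ Submodule.span ℝ (Set.range A.col), d ⬝ᵥ x = 0 := fun x hx => by
      induction hx using Submodule.span_induction with
      | mem x hx => obtain ⟨k, rfl⟩ := hx; exact hz k
      | zero => simp
      | add x y _ _ hx hy => rw [dotProduct_add, hx, hy, add_zero]
      | smul a x _ hx => rw [dotProduct_smul, hx, smul_zero]
    exact hd0 (dotProduct_self_eq_zero.1 (hall d (hspan ▸ Submodule.mem_top)))
  obtain ⟨d, hdT, hdb, hex⟩ := hblock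
  -- Ratio test: the minimal ratio is the longest step that stays dual feasible, and constraint `j`
  -- becomes tight.
  obtain ⟨j, hj, hjmin⟩ := Finset.exists_min_image
    (Finset.univ.filter fun k => 0 < (d ᵥ* A) k)
    (fun k => (c k - (p ᵥ* A) k) / (d ᵥ* A) k) (by
      obtain ⟨k, hk⟩ := hex
      exact ⟨k, by simpa using hk⟩)
  simp only [Finset.mem_filter, Finset.mem_univ, true_and] at hj hjmin
  set t := (c j - (p ᵥ* A) j) / (d ᵥ* A) j with ht
  have ht0 : 0 ≤ t := div_nonneg (sub_nonneg.2 (hpc j)) hj.le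
  have hval : ∀ k, ((p + t • d) ᵥ* A) k = (p ᵥ* A) k + t * (d ᵥ* A) k := fun k => by
    rw [add_vecMul, smul_vecMul]; rfl
  have htight : ((p + t • d) ᵥ* A) j = c j := by
    rw [hval, ht, div_mul_cancel₀ _ hj.ne']; ring
  refine hmin (p + t • d) ⟨fun k => ?_, ?_⟩ ?_
  · rw [hval]
    rcases lt_or_ge 0 ((d ᵥ* A) k) with hk | hk
    · have := (le_div_iff₀ hk).1 (hjmin k hk)
      linarith
    · have := hpc k
      nlinarith
  · rw [add_dotProduct, smul_dotProduct, smul_eq_mul]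
    nlinarith
  · refine Finset.card_lt_card (Finset.ssubset_iff_subset_ne.2 ⟨fun k hk => ?_, fun h => ?_⟩)
    · simp only [Finset.mem_filter, Finset.mem_univ, true_and] at hk ⊢
      exact fun hk' => hk (by rw [hval, hdT k hk', hk']; simp)
    · have hjp : (p ᵥ* A) j ≠ c j := fun h => hj.ne' (hdT j h)
      have : j ∈ Finset.univ.filter fun k => (p ᵥ* A) k ≠ c k := by simpa using hjp
      rw [← h] at this
      simp only [Finset.mem_filter, Finset.mem_univ, true_and] at this
      exact this htight

/-- A family of columns which spans contains a basis. -/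
theorem exists_basis_of_span_eq_top {m : ℕ} {κ : Type*} (A : Matrix (Fin m) κ ℝ) (T : Set κ)
    (hT : Submodule.span ℝ (A.col '' T) = ⊤) :
    ∃ B : Fin m → κ, (∀ i, B i ∈ T) ∧ IsUnit (A.submatrix id B).det := by
  obtain ⟨κ', a, -, hs, hli⟩ := exists_linearIndependent' ℝ (fun k : T => A.col k)
  have hr : Set.range (fun k : T => A.col k) = A.col '' T := by
    rw [Set.image_eq_range]
  rw [hr, hT] at hs
  let bs := Module.Basis.mk hli hs.ge
  let e := bs.indexEquiv (Pi.basisFun ℝ (Fin m))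
  refine ⟨fun i => a (e.symm i), fun i => (a (e.symm i)).2, ?_⟩
  rw [← Matrix.isUnit_iff_isUnit_det, ← Matrix.linearIndependent_cols_iff_isUnit]
  exact hli.comp _ e.symm.injective

/-- A bounded feasible linear program of full row rank has an optimal dual basic solution. -/
theorem exists_optimal_dual_basis {m : ℕ} {κ : Type*} [Fintype κ] (A : Matrix (Fin m) κ ℝ)
    (b : Fin m → ℝ) (c : κ → ℝ) (v : ℝ) (hrank : A.rank = m) (hne : (stdFeasible A b).Nonempty)
    (hv : ∀ y ∈ stdFeasible A b, v ≤ c ⬝ᵥ y) :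
    ∃ B : Fin m → κ, IsUnit (A.submatrix id B).det ∧
      (c ∘ B ᵥ* (A.submatrix id B)⁻¹) ᵥ* A ≤ c ∧ v ≤ (c ∘ B ᵥ* (A.submatrix id B)⁻¹) ⬝ᵥ b := by
  have hspan : Submodule.span ℝ (Set.range A.col) = ⊤ := by
    apply Submodule.eq_top_of_finrank_eq
    rw [← Matrix.rank_eq_finrank_span_cols, hrank, Module.finrank_fin_fun]
  obtain ⟨p, hpc, hpv, hT⟩ := exists_dual_vertex A b c v hne hspan
    (exists_dual_feasible A b c v hne hv)
  obtain ⟨B, hB, hdet⟩ := exists_basis_of_span_eq_top A _ hT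
  have h1 : p ᵥ* A.submatrix id B = c ∘ B := funext fun i => hB i
  have h2 : c ∘ B ᵥ* (A.submatrix id B)⁻¹ = p := by
    rw [← h1, vecMul_vecMul, mul_nonsing_inv _ hdet, vecMul_one]
  exact ⟨B, hdet, by rwa [h2], by rwa [h2]⟩

/-! ### Concentration of the norm of a sum of independent vectors -/

section Concentration

variable {Ω E : Type*} [Fintype Ω] [NormedAddCommGroup E]

/-- The expectation of `F (ω 0, …, ω (k - 1))` for `k` independent draws from the weights `q`. -/
def iidMean (q : Ω → ℝ) (k : ℕ) (F : (Fin k → Ω) → ℝ) : ℝ :=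
  ∑ ω, (∏ r, q (ω r)) * F ω

theorem iidMean_zero (q : Ω → ℝ) (F : (Fin 0 → Ω) → ℝ) : iidMean q 0 F = F Fin.elim0 := by
  simp [iidMean, Subsingleton.elim default (Fin.elim0 : Fin 0 → Ω)]

theorem iidMean_succ (q : Ω → ℝ) (k : ℕ) (F : (Fin (k + 1) → Ω) → ℝ) :
    iidMean q (k + 1) F = ∑ x, q x * iidMean q k fun ω => F (Fin.cons x ω) := by
  simp only [iidMean]
  rw [← (Fin.consEquiv fun _ : Fin (k + 1) => Ω).sum_comp, Fintype.sum_prod_type]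
  refine Finset.sum_congr rfl fun x _ => ?_
  rw [Finset.mul_sum]
  refine Finset.sum_congr rfl fun ω _ => ?_
  simp [Fin.consEquiv, Fin.prod_univ_succ, mul_assoc]

theorem iidMean_mono {q : Ω → ℝ} (hq : 0 ≤ q) {k : ℕ} {F G : (Fin k → Ω) → ℝ} (h : F ≤ G) :
    iidMean q k F ≤ iidMean q k G :=
  Finset.sum_le_sum fun ω _ =>
    mul_le_mul_of_nonneg_left (h ω) (Finset.prod_nonneg fun _ _ => hq _)

theorem iidMean_mul_left (q : Ω → ℝ) (k : ℕ) (a : ℝ) (F : (Fin k → Ω) → ℝ) :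
    iidMean q k (fun ω => a * F ω) = a * iidMean q k F := by
  simp only [iidMean, Finset.mul_sum]
  exact Finset.sum_congr rfl fun _ _ => by ring

theorem iidMean_add (q : Ω → ℝ) (k : ℕ) (F G : (Fin k → Ω) → ℝ) :
    iidMean q k (fun ω => F ω + G ω) = iidMean q k F + iidMean q k G := by
  simp only [iidMean, mul_add, Finset.sum_add_distrib]

theorem iidMean_const {q : Ω → ℝ} (hq1 : ∑ x, q x = 1) (k : ℕ) (a : ℝ) :
    iidMean q k (fun _ => a) = a := by
  simp only [iidMean, ← Finset.sum_mul]
  have : ∑ ω : Fin k → Ω, ∏ r, q (ω r) = 1 := by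
    rw [← Fintype.prod_sum (fun (_ : Fin k) x => q x)]
    simp [hq1]
  rw [this, one_mul]

/-- Variance of a sum of independent centered vectors. -/
theorem iidMean_norm_sq [InnerProductSpace ℝ E] {q : Ω → ℝ} (hq1 : ∑ x, q x = 1) (Y : Ω → E) (hY : ∑ x, q x • Y x = 0)
    (k : ℕ) (a : E) :
    iidMean q k (fun ω => ‖a + ∑ r, Y (ω r)‖ ^ 2) = ‖a‖ ^ 2 + k * ∑ x, q x * ‖Y x‖ ^ 2 := by
  induction k generalizing a with
  | zero => simp [iidMean_zero]
  | succ k ih =>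
    rw [iidMean_succ]
    simp only [Fin.sum_univ_succ, Fin.cons_zero, Fin.cons_succ, ← add_assoc, ih]
    simp only [mul_add, Finset.sum_add_distrib, ← Finset.sum_mul, hq1]
    have h1 : ∑ x, q x * ‖a + Y x‖ ^ 2 = ‖a‖ ^ 2 + ∑ x, q x * ‖Y x‖ ^ 2 := by
      have h2 : ∑ x, q x * inner ℝ a (Y x) = 0 := by
        have := congrArg (inner ℝ a) hY
        simpa [inner_sum, inner_smul_right] using this
      simp only [norm_add_sq_real, mul_add, Finset.sum_add_distrib, ← Finset.sum_mul, hq1]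
      have h3 : ∑ x, q x * (2 * inner ℝ a (Y x)) = 2 * ∑ x, q x * inner ℝ a (Y x) := by
        rw [Finset.mul_sum]; exact Finset.sum_congr rfl fun _ _ => by ring
      rw [h3, h2]; ring
    rw [h1]; push_cast; ring

/-- Jensen's inequality for the square. -/
theorem iidMean_sq_le {q : Ω → ℝ} (hq : 0 ≤ q) (hq1 : ∑ x, q x = 1) (k : ℕ)
    (F : (Fin k → Ω) → ℝ) : iidMean q k F ^ 2 ≤ iidMean q k fun ω => F ω ^ 2 := by
  set μ := iidMean q k F with hμ
  -- The square lies above its tangent line at the mean `μ`.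
  have h : iidMean q k (fun ω => μ ^ 2 + (-2 * μ) * (μ - F ω)) ≤ iidMean q k fun ω => F ω ^ 2 :=
    iidMean_mono hq fun ω => by
      show μ ^ 2 + (-2 * μ) * (μ - F ω) ≤ F ω ^ 2
      nlinarith [sq_nonneg (F ω - μ)]
  have h2 : iidMean q k (fun ω => μ - F ω) = 0 := by
    have : (fun ω => μ - F ω) = fun ω => μ + (-1) * F ω := by funext; ring
    rw [this, iidMean_add, iidMean_const hq1, iidMean_mul_left, ← hμ]; ring
  rw [iidMean_add, iidMean_const hq1, iidMean_mul_left, h2] at h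
  linarith

/-- Hoeffding's lemma for a finite probability space. -/
theorem sum_exp_le {q : Ω → ℝ} (hq : 0 ≤ q) (hq1 : ∑ x, q x = 1) (h : Ω → ℝ) (D : ℝ)
    (hD : ∀ x y, h x - h y ≤ 2 * D) (l : ℝ) :
    ∑ x, q x * Real.exp (l * (h x - ∑ y, q y * h y)) ≤ Real.exp (l ^ 2 * D ^ 2 / 2) := by
  classical
  have hne : Nonempty Ω := by
    by_contra hemp
    rw [not_nonempty_iff] at hemp
    simp at hq1
  let _ : MeasurableSpace Ω := ⊤
  let p : PMF Ω := PMF.ofFintype (fun x => ENNReal.ofReal (q x)) (by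
    rw [← ENNReal.ofReal_sum_of_nonneg fun x _ => hq x, hq1, ENNReal.ofReal_one])
  have hint : ∀ f : Ω → ℝ, ∫ x, f x ∂p.toMeasure = ∑ x, q x * f x := fun f => by
    rw [PMF.integral_eq_sum]
    exact Finset.sum_congr rfl fun x _ => by
      simp [p, PMF.ofFintype_apply, ENNReal.toReal_ofReal (hq x)]
  obtain ⟨x0, -, hx0⟩ := Finset.exists_min_image Finset.univ h Finset.univ_nonempty
  -- The values of `h` fill an interval of length at most `2 * D`, so the variance proxy is `D ^ 2`.
  have hsub := ProbabilityTheory.hasSubgaussianMGF_of_mem_Icc (μ := p.toMeasure) (X := h)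
    (a := h x0) (b := h x0 + 2 * D) (Measurable.aemeasurable fun _ _ => trivial)
    (Filter.Eventually.of_forall fun x => ⟨hx0 x (Finset.mem_univ _), by linarith [hD x x0]⟩)
  have := hsub.mgf_le l
  rw [ProbabilityTheory.mgf, hint, hint] at this
  refine this.trans (Real.exp_le_exp.2 (le_of_eq ?_))
  simp only [NNReal.coe_pow, NNReal.coe_div, coe_nnnorm, Real.norm_eq_abs, NNReal.coe_ofNat,
    add_sub_cancel_left, div_pow, sq_abs]
  ring

/-- The norm of a sum of independent bounded vectors is sub-Gaussian about its mean. -/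
theorem iidMean_exp_norm_le {q : Ω → ℝ} (hq : 0 ≤ q) (hq1 : ∑ x, q x = 1) (Y : Ω → E) (D : ℝ)
    (hD : ∀ x y, ‖Y x - Y y‖ ≤ 2 * D) (l : ℝ) (k : ℕ) (a : E) :
    iidMean q k (fun ω => Real.exp (l * (‖a + ∑ r, Y (ω r)‖ -
      iidMean q k fun ω => ‖a + ∑ r, Y (ω r)‖))) ≤ Real.exp (k * (l ^ 2 * D ^ 2 / 2)) := by
  induction k generalizing a with
  | zero => simp [iidMean_zero]
  | succ k ih =>
    -- `f (a + Y x)` is the conditional mean given the first draw `x`. As `f` is 1-Lipschitz, it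
    -- oscillates by at most `2 * D` in `x`, so Hoeffding's lemma handles this draw and induction
    -- the others.
    set f : E → ℝ := fun a => iidMean q k fun ω => ‖a + ∑ r, Y (ω r)‖ with hf
    have hlip : ∀ a b, f a - f b ≤ ‖a - b‖ := fun a b => by
      have : f a ≤ iidMean q k fun ω => ‖a - b‖ + ‖b + ∑ r, Y (ω r)‖ := iidMean_mono hq fun ω => by
        have := norm_add_le (a - b) (b + ∑ r, Y (ω r))
        rwa [← add_assoc, sub_add_cancel] at this
      rw [iidMean_add, iidMean_const hq1] at this
      linarith
    rw [iidMean_succ, iidMean_succ]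
    simp only [Fin.sum_univ_succ, Fin.cons_zero, Fin.cons_succ, ← add_assoc]
    change ∑ x, q x * iidMean q k (fun ω => Real.exp (l * (‖a + Y x + ∑ r, Y (ω r)‖ -
      ∑ y, q y * f (a + Y y)))) ≤ _
    calc _ ≤ ∑ x, q x * (Real.exp (l * (f (a + Y x) - ∑ y, q y * f (a + Y y))) *
          Real.exp (k * (l ^ 2 * D ^ 2 / 2))) := by
          refine Finset.sum_le_sum fun x _ => mul_le_mul_of_nonneg_left ?_ (hq x)
          have h1 : (fun ω : Fin k → Ω => Real.exp (l * (‖a + Y x + ∑ r, Y (ω r)‖ -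
              ∑ y, q y * f (a + Y y)))) = fun ω =>
              Real.exp (l * (f (a + Y x) - ∑ y, q y * f (a + Y y))) *
              Real.exp (l * (‖a + Y x + ∑ r, Y (ω r)‖ - f (a + Y x))) := by
            funext ω; rw [← Real.exp_add]; ring_nf
          rw [h1, iidMean_mul_left]
          exact mul_le_mul_of_nonneg_left (ih _) (Real.exp_nonneg _)
      _ = (∑ x, q x * Real.exp (l * (f (a + Y x) - ∑ y, q y * f (a + Y y)))) *
          Real.exp (k * (l ^ 2 * D ^ 2 / 2)) := by
          rw [Finset.sum_mul]; exact Finset.sum_congr rfl fun _ _ => by ring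
      _ ≤ Real.exp (l ^ 2 * D ^ 2 / 2) * Real.exp (k * (l ^ 2 * D ^ 2 / 2)) := by
          refine mul_le_mul_of_nonneg_right (sum_exp_le hq hq1 _ D (fun x y => ?_) l)
            (Real.exp_nonneg _)
          refine (hlip _ _).trans ?_
          rw [add_sub_add_left_eq_sub]; exact hD x y
      _ = _ := by rw [← Real.exp_add]; push_cast; ring_nf

/-- A high-probability bound for the norm of a sum of independent centered bounded vectors. -/
theorem iidMean_norm_sum_gt_le [InnerProductSpace ℝ E] {q : Ω → ℝ} (hq : 0 ≤ q)
    (hq1 : ∑ x, q x = 1) (X : Ω → E) (M : ℝ) (hM : ∀ x, ‖X x‖ ≤ M) (k : ℕ) (hk : 0 < k) (δ : ℝ) (hδ : 0 < δ) (hδ1 : δ ≤ 1) :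
    iidMean q k (fun ω => Set.indicator {ω : Fin k → Ω |
      M * Real.sqrt k * (1 + Real.sqrt (2 * Real.log (1 / δ))) <
        ‖∑ r, (X (ω r) - ∑ x, q x • X x)‖} 1 ω) ≤ δ := by
  set μ := ∑ x, q x • X x with hμ
  set Y : Ω → E := fun x => X x - μ with hYdef
  have hY : ∑ x, q x • Y x = 0 := by
    simp [hYdef, smul_sub, Finset.sum_sub_distrib, ← Finset.sum_smul, hq1, hμ]
  set L := Real.sqrt (2 * Real.log (1 / δ)) with hL
  have hL2 : L ^ 2 = 2 * Real.log (1 / δ) :=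
    Real.sq_sqrt (mul_nonneg zero_le_two (Real.log_nonneg (by rw [le_div_iff₀ hδ]; linarith)))
  have hL0 : 0 ≤ L := Real.sqrt_nonneg _
  obtain ⟨x0⟩ : Nonempty Ω := by
    by_contra hemp
    rw [not_nonempty_iff] at hemp
    simp at hq1
  have hM0 : 0 ≤ M := (norm_nonneg _).trans (hM x0)
  have hk' : (0 : ℝ) < k := Nat.cast_pos.2 hk
  have hsk : Real.sqrt k ^ 2 = k := Real.sq_sqrt hk'.le
  have hsk0 : 0 < Real.sqrt k := Real.sqrt_pos.2 hk'
  -- The exponent `l` below divides by `M`; for `M = 0` the strict inequality never occurs.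
  rcases hM0.eq_or_lt with h0 | hMpos
  · have hX : ∀ x, X x = 0 := fun x => norm_le_zero_iff.1 (h0 ▸ hM x)
    have hμ0 : μ = 0 := by simp [hμ, hX]
    simp [← h0, hX, hμ0, iidMean_const hq1, hδ.le]
  set S : (Fin k → Ω) → ℝ := fun ω => ‖∑ r, Y (ω r)‖ with hS
  have hmean : iidMean q k S ≤ M * Real.sqrt k := by
    refine le_of_sq_le_sq ?_ (by positivity)
    refine (iidMean_sq_le hq hq1 k S).trans ?_
    have h1 := iidMean_norm_sq hq1 Y hY k 0
    simp only [zero_add, norm_zero] at h1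
    rw [h1, mul_pow, hsk]
    have h2 : ∑ x, q x * ‖Y x‖ ^ 2 ≤ M ^ 2 := by
      have h3 : ∑ x, q x * ‖Y x‖ ^ 2 ≤ ∑ x, q x * ‖X x‖ ^ 2 := by
        -- One draw started at `μ` gives the second moment of `X` as `‖μ‖ ^ 2` plus the variance.
        have h4 := iidMean_norm_sq hq1 Y hY 1 μ
        rw [iidMean_succ] at h4
        simp [iidMean_zero, hYdef] at h4
        simp only [hYdef]
        rw [h4]
        exact le_add_of_nonneg_left (sq_nonneg _)
      refine h3.trans ?_
      calc _ ≤ ∑ x, q x * M ^ 2 := Finset.sum_le_sum fun x _ => mul_le_mul_of_nonneg_left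
              (pow_le_pow_left₀ (norm_nonneg _) (hM x) 2) (hq x)
        _ = M ^ 2 := by rw [← Finset.sum_mul, hq1, one_mul]
    nlinarith
  -- The optimal Chernoff exponent: the bound becomes `exp (-L² + L² / 2) = δ`.
  set l := L / (M * Real.sqrt k) with hl
  have hl0 : 0 ≤ l := by positivity
  have hexp := iidMean_exp_norm_le hq hq1 Y M (fun x y => by
    simp only [hYdef, sub_sub_sub_cancel_right]
    linarith [norm_sub_le (X x) (X y), hM x, hM y]) l k 0
  simp only [zero_add] at hexp
  change iidMean q k (fun ω => Real.exp (l * (S ω - iidMean q k S))) ≤ _ at hexp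
  have hlM : l * (M * Real.sqrt k) = L := div_mul_cancel₀ _ (by positivity)
  have hexp2 : k * (l ^ 2 * M ^ 2 / 2) = Real.log (1 / δ) := by
    have : k * (l ^ 2 * M ^ 2 / 2) = (l * (M * Real.sqrt k)) ^ 2 / 2 := by
      rw [mul_pow, mul_pow, hsk]; ring
    rw [this, hlM, hL2]; ring
  rw [hexp2] at hexp
  calc _ ≤ iidMean q k (fun ω => Real.exp (-L ^ 2) * Real.exp (l * (S ω - iidMean q k S))) := by
        refine iidMean_mono hq fun ω => ?_
        by_cases hω : ω ∈ {ω : Fin k → Ω | M * Real.sqrt k * (1 + L) < ‖∑ r, (X (ω r) - μ)‖}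
        swap
        · simp only [Set.indicator_of_notMem hω]
          positivity
        simp only [Set.indicator_of_mem hω]
        rw [← Real.exp_add, Pi.one_apply, Real.one_le_exp_iff]
        have h1 : M * Real.sqrt k * (1 + L) < S ω := hω
        have h2 : M * Real.sqrt k * L ≤ S ω - iidMean q k S := by linarith
        have h3 := mul_le_mul_of_nonneg_left h2 hl0
        rw [← mul_assoc, hlM] at h3
        nlinarith
    _ ≤ Real.exp (-L ^ 2) * Real.exp (Real.log (1 / δ)) := by
        rw [iidMean_mul_left]
        exact mul_le_mul_of_nonneg_left hexp (Real.exp_nonneg _)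
    _ = δ := by
        rw [← Real.exp_add, hL2]
        have : -(2 * Real.log (1 / δ)) + Real.log (1 / δ) = Real.log δ := by
          rw [one_div, Real.log_inv]; ring
        rw [this, Real.exp_log hδ]

end Concentration

/-! ### From the sampling error to the optimality gap -/

/-- The vector indexed by columns that results from giving the sampled column `J k` the
weight `y k`. -/
def push {n : ℕ} {κ : Type*} [Fintype κ] (J : κ → Fin n) (y : κ → ℝ) : Fin n → ℝ :=
  ∑ k, y k • Pi.single (J k) 1

theorem dotProduct_push {n : ℕ} {κ : Type*} [Fintype κ] (J : κ → Fin n) (y : κ → ℝ)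
    (z : Fin n → ℝ) : z ⬝ᵥ push J y = (z ∘ J) ⬝ᵥ y := by
  rw [push, dotProduct_sum]
  simp only [dotProduct_smul, dotProduct_single, mul_one, smul_eq_mul]
  exact Finset.sum_congr rfl fun k _ => mul_comm _ _

theorem mulVec_push {m n : ℕ} {κ : Type*} [Fintype κ] (A : Matrix (Fin m) (Fin n) ℝ)
    (J : κ → Fin n) (y : κ → ℝ) : A *ᵥ push J y = cols A J *ᵥ y :=
  funext fun i => dotProduct_push J y (A i)

theorem push_nonneg {n : ℕ} {κ : Type*} [Fintype κ] (J : κ → Fin n) {y : κ → ℝ} (hy : 0 ≤ y) :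
    0 ≤ push J y :=
  Finset.sum_nonneg fun k _ => smul_nonneg (hy k) (Pi.single_nonneg.2 zero_le_one)

theorem push_mem_stdFeasible {m n : ℕ} {κ : Type*} [Fintype κ] {A : Matrix (Fin m) (Fin n) ℝ}
    {b : Fin m → ℝ} {J : κ → Fin n} {y : κ → ℝ} (hy : y ∈ sampledFeasible A b J) :
    push J y ∈ stdFeasible A b :=
  ⟨(mulVec_push A J y).trans hy.1, push_nonneg J hy.2⟩

/-- The optimal value of a feasible bounded linear program is finite. -/
theorem exists_optValue_eq {ι : Type*} [Fintype ι] (c : ι → ℝ) (F : Set (ι → ℝ))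
    (hne : F.Nonempty) (L : ℝ) (hL : ∀ x ∈ F, L ≤ c ⬝ᵥ x) :
    ∃ v : ℝ, optValue c F = v ∧ ∀ x ∈ F, v ≤ c ⬝ᵥ x := by
  obtain ⟨x0, hx0⟩ := hne
  have hle : ∀ x ∈ F, optValue c F ≤ ((c ⬝ᵥ x : ℝ) : EReal) := fun x hx => iInf₂_le x hx
  have htop : optValue c F ≠ ⊤ := ((hle x0 hx0).trans_lt (EReal.coe_lt_top _)).ne
  have hbot : optValue c F ≠ ⊥ :=
    ((EReal.bot_lt_coe L).trans_le (le_iInf₂ fun x hx => EReal.coe_le_coe_iff.2 (hL x hx))).ne'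
  refine ⟨(optValue c F).toReal, (EReal.coe_toReal htop hbot).symm, fun x hx => ?_⟩
  rw [← EReal.coe_le_coe_iff, EReal.coe_toReal htop hbot]
  exact hle x hx

/-- The optimal value of the sampled problem exceeds the cost of a solution `x` by at most the
reduced cost of the difference between a reweighted sample and `x`, for some basis. -/
theorem exists_optValue_sampled_le {m n : ℕ} {κ : Type*} [Fintype κ]
    (A : Matrix (Fin m) (Fin n) ℝ) (b : Fin m → ℝ) (c : Fin n → ℝ)
    (hbdd : BddBelow ((fun x => c ⬝ᵥ x) '' stdFeasible A b)) (J : κ → Fin n)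
    (hne : (sampledFeasible A b J).Nonempty) (hrank : (cols A J).rank = m)
    (x : Fin n → ℝ) (hx : A *ᵥ x = b) (y : κ → ℝ) (hy : 0 ≤ y) :
    ∃ B : Fin m → Fin n, IsBasis A B ∧ optValue (c ∘ J) (sampledFeasible A b J) ≤
      ((c ⬝ᵥ x + reducedCost A c B ⬝ᵥ (push J y - x) : ℝ) : EReal) := by
  obtain ⟨L, hL⟩ := hbdd
  obtain ⟨v, hv, hvle⟩ := exists_optValue_eq (c ∘ J) (sampledFeasible A b J) hne L fun z hz => by
    rw [← dotProduct_push]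
    exact hL ⟨_, push_mem_stdFeasible hz, rfl⟩
  obtain ⟨B, hdet, hdual, hval⟩ := exists_optimal_dual_basis (cols A J) b (c ∘ J) v hrank hne hvle
  refine ⟨J ∘ B, hdet, ?_⟩
  rw [hv, EReal.coe_le_coe_iff]
  change dualBasicSol A c (J ∘ B) ᵥ* cols A J ≤ c ∘ J at hdual
  change v ≤ dualBasicSol A c (J ∘ B) ⬝ᵥ b at hval
  set p := dualBasicSol A c (J ∘ B) with hp
  -- Dual feasibility for `P_J` is nonnegativity of the reduced costs on sampled columns, so this
  -- needs only `y ≥ 0`, not `A_J y = b`.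
  have h1 : 0 ≤ reducedCost A c (J ∘ B) ⬝ᵥ push J y := by
    rw [dotProduct_push]
    refine Finset.sum_nonneg fun k _ => mul_nonneg ?_ (hy k)
    exact sub_nonneg.2 (hdual k)
  have h2 : reducedCost A c (J ∘ B) ⬝ᵥ x = c ⬝ᵥ x - p ⬝ᵥ b := by
    rw [reducedCost, sub_dotProduct, ← hp, ← dotProduct_mulVec, hx]
  rw [dotProduct_sub, h2]
  linarith

/-- A bound on the reduced cost of the sampling error bounds the optimality gap. -/
theorem gapBound_of_reducedCost_le {m n : ℕ} {κ : Type*} [Fintype κ]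
    (A : Matrix (Fin m) (Fin n) ℝ) (b : Fin m → ℝ) (c : Fin n → ℝ)
    (hfeas : (stdFeasible A b).Nonempty)
    (hbdd : BddBelow ((fun x => c ⬝ᵥ x) '' stdFeasible A b)) (C : ℝ) (ξ x : Fin n → ℝ)
    (hx : A *ᵥ x = b) (hopt : ∀ z ∈ distrFeasible A b C ξ, c ⬝ᵥ x ≤ c ⬝ᵥ z)
    (J : κ → Fin n) (y : κ → ℝ) (hy : 0 ≤ y) (ε : ℝ)
    (hε : ∀ B : Fin m → Fin n, IsBasis A B → reducedCost A c B ⬝ᵥ (push J y - x) ≤ ε) :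
    GapBound A b c C ξ ε J := by
  intro hne hrank
  obtain ⟨B, hB, hle⟩ := exists_optValue_sampled_le A b c hbdd J hne hrank x hx y hy
  obtain ⟨L, hL⟩ := hbdd
  obtain ⟨v, hv, -⟩ := exists_optValue_eq c (stdFeasible A b) hfeas L fun z hz => hL ⟨z, hz, rfl⟩
  rw [gap, gap, hv]
  have h1 : ((c ⬝ᵥ x : ℝ) : EReal) ≤ optValue c (distrFeasible A b C ξ) :=
    le_iInf₂ fun z hz => EReal.coe_le_coe_iff.2 (hopt z hz)
  have h2 : optValue (c ∘ J) (sampledFeasible A b J) ≤ ((c ⬝ᵥ x + ε : ℝ) : EReal) :=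
    hle.trans (EReal.coe_le_coe_iff.2 (by linarith [hε B hB]))
  calc _ ≤ ((c ⬝ᵥ x + ε : ℝ) : EReal) - v := EReal.sub_le_sub h2 le_rfl
    _ = ((c ⬝ᵥ x : ℝ) : EReal) - v + ε := by
      rw [← EReal.coe_sub, ← EReal.coe_sub, ← EReal.coe_add, EReal.coe_eq_coe_iff]; ring
    _ ≤ _ := add_le_add (EReal.sub_le_sub h1 le_rfl) le_rfl

/-- Since `v(P)` is finite, the gap on the right is `+∞`, and adding a real number leaves it so. -/
theorem gapBound_of_distr_infeasible {m n : ℕ} {κ : Type*} [Fintype κ]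
    (A : Matrix (Fin m) (Fin n) ℝ) (b : Fin m → ℝ) (c : Fin n → ℝ)
    (hfeas : (stdFeasible A b).Nonempty)
    (hbdd : BddBelow ((fun x => c ⬝ᵥ x) '' stdFeasible A b)) (C : ℝ) (ξ : Fin n → ℝ)
    (hemp : distrFeasible A b C ξ = ∅) (J : κ → Fin n) (ε : ℝ) : GapBound A b c C ξ ε J := by
  intro _ _
  obtain ⟨L, hL⟩ := hbdd
  obtain ⟨v, hv, -⟩ := exists_optValue_eq c (stdFeasible A b) hfeas L fun z hz => hL ⟨z, hz, rfl⟩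
  rw [gap, gap, hv, hemp]
  simp [optValue]

/-- The distributional counterpart attains its optimal value if it is feasible. -/
theorem exists_distr_optimal {m n : ℕ} (A : Matrix (Fin m) (Fin n) ℝ) (b : Fin m → ℝ)
    (c : Fin n → ℝ) (C : ℝ) (ξ : Fin n → ℝ) (hne : (distrFeasible A b C ξ).Nonempty) :
    ∃ x ∈ distrFeasible A b C ξ, ∀ z ∈ distrFeasible A b C ξ, c ⬝ᵥ x ≤ c ⬝ᵥ z := by
  have hcomp : IsCompact (distrFeasible A b C ξ) := by
    have h : distrFeasible A b C ξ = {x | A *ᵥ x = b} ∩ Set.Icc 0 (C • ξ) := rfl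
    rw [h]
    exact isCompact_Icc.inter_left
      (isClosed_eq (Continuous.matrix_mulVec continuous_const continuous_id) continuous_const)
  exact hcomp.exists_isMinOn hne (Continuous.dotProduct continuous_const continuous_id).continuousOn

/-! ### Rounds as independent draws -/

namespace GroupScheme

variable {n nG : ℕ} (S : GroupScheme n nG)

/-- The probability that a round of sampling produces given indices. -/
def roundWeight (s : Fin nG → Fin n) : ℝ := (S.roundLaw s).toReal

theorem roundWeight_nonneg : 0 ≤ S.roundWeight := fun _ => ENNReal.toReal_nonneg

theorem sum_roundWeight : ∑ s, S.roundWeight s = 1 := by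
  have h := S.roundLaw.tsum_coe
  rw [tsum_fintype] at h
  simp only [roundWeight]
  rw [← ENNReal.toReal_sum fun s _ => S.roundLaw.apply_ne_top s, h, ENNReal.toReal_one]

theorem sum_roundWeight_ite (i : Fin nG) (t : Fin n) :
    ∑ s, (if s i = t then S.roundWeight s else 0) = S.xi t := by
  have h := S.drawFrom_marginal nG Finset.univ (Finset.card_fin nG) i t
  rw [Finset.sum_eq_single (S.group t) (fun g _ hg => S.dist_eq_zero g t hg.symm) (by simp),
    PMF.map_apply, tsum_fintype] at h
  have h' := congrArg ENNReal.toReal h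
  rw [ENNReal.toReal_sum] at h'
  · rw [xi, one_div]
    simp only [ENNReal.toReal_mul, ENNReal.toReal_inv, ENNReal.toReal_natCast] at h'
    rw [← h']
    refine Finset.sum_congr rfl fun s _ => ?_
    by_cases hs : s i = t
    · simp [hs, roundWeight, roundLaw]
    · simp [hs, Ne.symm hs]
  · intro s _
    split_ifs
    · exact PMF.apply_ne_top _ _
    · exact ENNReal.zero_ne_top

instance isProbabilityMeasure_sampleLaw (nr : ℕ) : IsProbabilityMeasure (S.sampleLaw nr) := by
  unfold sampleLaw; infer_instance

theorem sampleLaw_real_eq (nr : ℕ) (s : Set (Fin nr → Fin nG → Fin n)) :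
    (S.sampleLaw nr).real s = iidMean S.roundWeight nr (s.indicator 1) := by
  classical
  have hs : s = ↑(Finset.univ.filter fun ω => ω ∈ s) := by ext; simp
  have hfin : ∀ ω, (S.sampleLaw nr).real {ω} = ∏ r, S.roundWeight (ω r) := fun ω => by
    rw [measureReal_def, sampleLaw, Measure.pi_singleton, ENNReal.toReal_prod]
    refine Finset.prod_congr rfl fun r _ => ?_
    rw [PMF.toMeasure_apply_singleton _ _ (measurableSet_singleton _)]
    rfl
  conv_lhs => rw [hs]
  rw [← sum_measureReal_singleton, Finset.sum_filter, iidMean]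
  refine Finset.sum_congr rfl fun ω _ => ?_
  by_cases h : ω ∈ s <;> simp [h, hfin]

theorem one_sub_le_sampleLaw {nr : ℕ} {s : Set (Fin nr → Fin nG → Fin n)} {δ : ℝ}
    (h : (S.sampleLaw nr).real sᶜ ≤ δ) : 1 - δ ≤ (S.sampleLaw nr).real s := by
  rw [probReal_compl_eq_one_sub (Set.toFinite _).measurableSet] at h
  linarith

/-- The reweighted indices of one round. -/
def roundVec (w : Fin n → ℝ) (s : Fin nG → Fin n) : Fin n → ℝ :=
  (nG : ℝ)⁻¹ • ∑ i, w (s i) • Pi.single (s i) 1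

/-- By linearity only the marginal law of each index enters, so dependence within the round is
harmless. -/
theorem sum_roundWeight_smul_roundVec (hG : 0 < nG) (w : Fin n → ℝ) :
    ∑ s, S.roundWeight s • roundVec w s = fun t => w t * S.xi t := by
  funext t
  have h : ∀ s : Fin nG → Fin n, (S.roundWeight s • roundVec w s) t =
      (nG : ℝ)⁻¹ * ∑ i, w t * (if s i = t then S.roundWeight s else 0) := fun s => by
    simp only [roundVec, Pi.smul_apply, Finset.sum_apply, smul_eq_mul]
    rw [mul_left_comm, Finset.mul_sum]
    congr 1
    refine Finset.sum_congr rfl fun i _ => ?_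
    by_cases hs : s i = t
    · subst hs; simp [mul_comm]
    · simp [hs, Ne.symm hs]
  rw [Finset.sum_apply, Finset.sum_congr rfl fun s _ => h s, ← Finset.mul_sum, Finset.sum_comm]
  simp only [← Finset.mul_sum, sum_roundWeight_ite]
  have : (nG : ℝ) ≠ 0 := Nat.cast_ne_zero.2 hG.ne'
  simp
  field_simp

/-- A round is an average of `nG` vectors of norm at most `C * M`, whatever their dependence. This
is why the rate is in `nr` rather than `K`. -/
theorem norm_map_roundVec_le {E : Type*} [NormedAddCommGroup E] [NormedSpace ℝ E] (hG : 0 < nG)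
    (T : (Fin n → ℝ) →ₗ[ℝ] E) {M C : ℝ} (hT : ∀ t, ‖T (Pi.single t 1)‖ ≤ M)
    {w : Fin n → ℝ} (hw : 0 ≤ w) (hwC : ∀ t, w t ≤ C) (s : Fin nG → Fin n) :
    ‖T (roundVec w s)‖ ≤ C * M := by
  have hG' : (0 : ℝ) < nG := Nat.cast_pos.2 hG
  rw [roundVec, map_smul, map_sum, norm_smul, norm_inv, Real.norm_natCast, inv_mul_le_iff₀ hG']
  calc ‖∑ i, T (w (s i) • Pi.single (s i) 1)‖ ≤ ∑ _i : Fin nG, C * M :=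
        norm_sum_le_of_le _ fun i _ => by
          rw [map_smul, norm_smul, Real.norm_of_nonneg (hw _)]
          exact mul_le_mul (hwC _) (hT _) (norm_nonneg _) ((hw (s i)).trans (hwC (s i)))
    _ = nG * (C * M) := by simp

/-- The weights of the sampled columns that turn a solution with density `w` relative to the
sampling distribution into an empirical average. -/
def sampleWeight {nr : ℕ} (w : Fin n → ℝ) (ω : Fin nr → Fin nG → Fin n) : Fin nr × Fin nG → ℝ :=
  fun k => (nr : ℝ)⁻¹ * (nG : ℝ)⁻¹ * w (ω k.1 k.2)

theorem push_sampleWeight {nr : ℕ} (w : Fin n → ℝ) (ω : Fin nr → Fin nG → Fin n) :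
    push (indices ω) (sampleWeight w ω) = (nr : ℝ)⁻¹ • ∑ r, roundVec w (ω r) := by
  simp only [push, roundVec, sampleWeight, indices, Fintype.sum_prod_type, Finset.smul_sum,
    smul_smul, mul_assoc]

/-- A linear image of the empirical average concentrates around its mean. -/
theorem sampleLaw_norm_gt_le {E : Type*} [NormedAddCommGroup E] [InnerProductSpace ℝ E]
    {nr : ℕ} (hnr : 0 < nr) (hG : 0 < nG)
    (T : (Fin n → ℝ) →ₗ[ℝ] E) {M C : ℝ} (hT : ∀ t, ‖T (Pi.single t 1)‖ ≤ M)
    {w : Fin n → ℝ} (hw : 0 ≤ w) (hwC : ∀ t, w t ≤ C) {δ : ℝ} (hδ : 0 < δ) (hδ1 : δ ≤ 1) :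
    (S.sampleLaw nr).real {ω | ‖T (push (indices ω) (sampleWeight w ω) - fun t => w t * S.xi t)‖ ≤
      C * M / Real.sqrt nr * (1 + Real.sqrt (2 * Real.log (1 / δ)))}ᶜ ≤ δ := by
  have h := iidMean_norm_sum_gt_le S.roundWeight_nonneg S.sum_roundWeight
    (fun s => T (roundVec w s)) (C * M) (norm_map_roundVec_le hG T hT hw hwC) nr hnr δ hδ hδ1
  rw [← sampleLaw_real_eq] at h
  refine (measureReal_mono fun ω hω => ?_).trans h
  simp only [Set.mem_compl_iff, Set.mem_ofPred_eq, not_le] at hω ⊢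
  have hr : (0 : ℝ) < nr := Nat.cast_pos.2 hnr
  have hr' : (nr : ℝ) ≠ 0 := hr.ne'
  have h1 : ∑ r, (T (roundVec w (ω r)) - ∑ s, S.roundWeight s • T (roundVec w s)) =
      (nr : ℝ) • T (push (indices ω) (sampleWeight w ω) - fun t => w t * S.xi t) := by
    rw [push_sampleWeight, ← S.sum_roundWeight_smul_roundVec hG]
    simp only [map_sub, map_smul, map_sum, Finset.sum_sub_distrib, smul_sub, smul_smul,
      mul_inv_cancel₀ hr', one_smul]
    simp [← Nat.cast_smul_eq_nsmul ℝ]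
  rw [h1, norm_smul, Real.norm_natCast]
  have h2 := mul_lt_mul_of_pos_left hω hr
  refine lt_of_eq_of_lt ?_ h2
  have h3 : Real.sqrt nr ≠ 0 := (Real.sqrt_pos.2 hr).ne'
  have h4 : Real.sqrt nr * Real.sqrt nr = nr := Real.mul_self_sqrt hr.le
  field_simp
  rw [pow_two, h4]

end GroupScheme

/-! ### Norm estimates for the two bounds -/

theorem l2norm_eq_norm {n : ℕ} (v : Fin n → ℝ) : l2norm v = ‖WithLp.toLp 2 v‖ := by
  simp [l2norm, EuclideanSpace.norm_eq]

theorem dotProduct_le_l2norm {n : ℕ} (u v : Fin n → ℝ) : u ⬝ᵥ v ≤ l2norm u * l2norm v :=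
  Real.sum_mul_le_sqrt_mul_sqrt _ _ _

theorem l2norm_nonneg {n : ℕ} (v : Fin n → ℝ) : 0 ≤ l2norm v := Real.sqrt_nonneg _

theorem l2norm_neg {n : ℕ} (v : Fin n → ℝ) : l2norm (-v) = l2norm v := by simp [l2norm]

theorem l2norm_le_sqrt_mul {n : ℕ} {v : Fin n → ℝ} {a : ℝ} (ha : 0 ≤ a) (h : ∀ i, |v i| ≤ a) :
    l2norm v ≤ Real.sqrt n * a := by
  rw [l2norm, ← Real.sqrt_sq ha, ← Real.sqrt_mul (Nat.cast_nonneg n)]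
  refine Real.sqrt_le_sqrt ?_
  calc ∑ j, v j ^ 2 ≤ ∑ _j : Fin n, a ^ 2 := Finset.sum_le_sum fun j _ => by
        rw [← sq_abs]; exact pow_le_pow_left₀ (abs_nonneg _) (h j) 2
    _ = n * a ^ 2 := by simp

theorem abs_le_linfNorm {m : ℕ} (v : Fin m → ℝ) (i : Fin m) : |v i| ≤ linfNorm v :=
  le_ciSup (f := fun i => |v i|) (Set.finite_range _).bddAbove i

theorem linfNorm_nonneg {m : ℕ} (v : Fin m → ℝ) : 0 ≤ linfNorm v :=
  Real.iSup_nonneg fun _ => abs_nonneg _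

theorem abs_le_maxNorm {m n : ℕ} (A : Matrix (Fin m) (Fin n) ℝ) (i : Fin m) (j : Fin n) :
    |A i j| ≤ maxNorm A :=
  (le_ciSup (f := fun j => |A i j|) (Set.finite_range _).bddAbove j).trans
    (le_ciSup (f := fun i => ⨆ j, |A i j|) (Set.finite_range _).bddAbove i)

theorem maxNorm_nonneg {m n : ℕ} (A : Matrix (Fin m) (Fin n) ℝ) : 0 ≤ maxNorm A :=
  Real.iSup_nonneg fun _ => Real.iSup_nonneg fun _ => abs_nonneg _

theorem reducedCost_dotProduct_le_of_l2norm {m n : ℕ} {A : Matrix (Fin m) (Fin n) ℝ}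
    {c : Fin n → ℝ} {B : Fin m → Fin n} {χ r : ℝ} (hχ : l2norm (reducedCost A c B) ≤ χ)
    {d : Fin n → ℝ} (hd : l2norm d ≤ r) : reducedCost A c B ⬝ᵥ d ≤ χ * r :=
  (dotProduct_le_l2norm _ _).trans
    (mul_le_mul hχ hd (l2norm_nonneg _) ((l2norm_nonneg _).trans hχ))

/-- Cauchy–Schwarz on each term of `cᵀd - pᵀ(A d)`; passing from the maximum norm of `p` to its
Euclidean norm costs `√m`. -/
theorem reducedCost_dotProduct_le_of_linfNorm {m n : ℕ} {A : Matrix (Fin m) (Fin n) ℝ}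
    {c : Fin n → ℝ} {B : Fin m → Fin n} {γ r s : ℝ} (hc : l2norm c = 1)
    (hγ : linfNorm (dualBasicSol A c B) ≤ γ) {d : Fin n → ℝ} (hd : l2norm d ≤ r)
    (hAd : l2norm (A *ᵥ d) ≤ s) : reducedCost A c B ⬝ᵥ d ≤ r + Real.sqrt m * γ * s := by
  have hγ0 : 0 ≤ γ := (linfNorm_nonneg _).trans hγ
  have h1 : c ⬝ᵥ d ≤ r := (dotProduct_le_l2norm c d).trans (by rwa [hc, one_mul])
  have h2 : -dualBasicSol A c B ⬝ᵥ (A *ᵥ d) ≤ Real.sqrt m * γ * s := by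
    refine (dotProduct_le_l2norm _ _).trans (mul_le_mul ?_ hAd (l2norm_nonneg _) (by positivity))
    rw [l2norm_neg]
    exact l2norm_le_sqrt_mul hγ0 fun i => (abs_le_linfNorm _ i).trans hγ
  rw [reducedCost, sub_dotProduct, ← dotProduct_mulVec]
  rw [neg_dotProduct] at h2
  linarith

namespace GroupScheme

variable {n nG : ℕ} (S : GroupScheme n nG)

/-- A solution dominated by `C ξ` has a density bounded by `C` relative to `ξ`. -/
theorem exists_density {C : ℝ} (hC : 0 ≤ C) {x : Fin n → ℝ} (hx0 : 0 ≤ x) (hxC : x ≤ C • S.xi) :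
    ∃ w : Fin n → ℝ, 0 ≤ w ∧ (∀ t, w t ≤ C) ∧ x = fun t => w t * S.xi t := by
  have hξ : ∀ t, 0 ≤ S.xi t := fun t =>
    mul_nonneg (by positivity) ENNReal.toReal_nonneg
  -- Where `S.xi t = 0` the constraint forces `x t = 0`, so the default value `0` of the quotient is
  -- consistent.
  refine ⟨fun t => x t / S.xi t, fun t => div_nonneg (hx0 t) (hξ t), fun t => ?_, ?_⟩
  · exact div_le_of_le_mul₀ (hξ t) hC (hxC t)
  · funext t
    by_cases h : S.xi t = 0
    · have h1 := hxC t
      rw [Pi.smul_apply, h, smul_zero] at h1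
      simp [h, le_antisymm h1 (hx0 t)]
    · rw [div_mul_cancel₀ _ h]

theorem sampleLaw_l2norm_gt_le {nr : ℕ} (hnr : 0 < nr) (hG : 0 < nG) {C : ℝ}
    {w : Fin n → ℝ} (hw : 0 ≤ w) (hwC : ∀ t, w t ≤ C) {δ : ℝ} (hδ : 0 < δ) (hδ1 : δ ≤ 1) :
    (S.sampleLaw nr).real {ω | l2norm (push (indices ω) (sampleWeight w ω) -
      fun t => w t * S.xi t) ≤
      C / Real.sqrt nr * (1 + Real.sqrt (2 * Real.log (1 / δ)))}ᶜ ≤ δ := by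
  have := S.sampleLaw_norm_gt_le hnr hG (WithLp.linearEquiv 2 ℝ (Fin n → ℝ)).symm.toLinearMap
    (M := 1) (fun t => by
      change ‖WithLp.toLp 2 (Pi.single t 1)‖ ≤ 1
      rw [← l2norm_eq_norm]
      simp [l2norm, Pi.single_apply]) hw hwC hδ hδ1
  rw [mul_one] at this
  simp only [l2norm_eq_norm]
  exact this

/-- Unit vectors are mapped to columns of `A`, of Euclidean norm at most `√m * maxNorm A`. -/
theorem sampleLaw_l2norm_mulVec_gt_le {m nr : ℕ} (hnr : 0 < nr) (hG : 0 < nG)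
    (A : Matrix (Fin m) (Fin n) ℝ) {C : ℝ}
    {w : Fin n → ℝ} (hw : 0 ≤ w) (hwC : ∀ t, w t ≤ C) {δ : ℝ} (hδ : 0 < δ) (hδ1 : δ ≤ 1) :
    (S.sampleLaw nr).real {ω | l2norm (A *ᵥ (push (indices ω) (sampleWeight w ω) -
      fun t => w t * S.xi t)) ≤
      C * (Real.sqrt m * maxNorm A) / Real.sqrt nr *
        (1 + Real.sqrt (2 * Real.log (1 / δ)))}ᶜ ≤ δ := by
  have := S.sampleLaw_norm_gt_le hnr hG
    ((WithLp.linearEquiv 2 ℝ (Fin m → ℝ)).symm.toLinearMap ∘ₗ A.mulVecLin)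
    (M := Real.sqrt m * maxNorm A) (fun t => by
      change ‖WithLp.toLp 2 (A *ᵥ Pi.single t 1)‖ ≤ _
      rw [← l2norm_eq_norm, mulVec_single_one]
      exact l2norm_le_sqrt_mul (maxNorm_nonneg A) fun i => abs_le_maxNorm A i t) hw hwC hδ hδ1
  simp only [l2norm_eq_norm]
  exact this

end GroupScheme

end ColumnSampling

end

/-! ### Assembly of the two bounds -/

theorem mainTheorem4
    (m n nG nr : ℕ) (hnr : 0 < nr)
    (A : Matrix (Fin m) (Fin n) ℝ) (b : Fin m → ℝ) (c : Fin n → ℝ)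
    (hfeas : (ColumnSampling.stdFeasible A b).Nonempty)
    (hbdd : BddBelow ((fun x => c ⬝ᵥ x) '' ColumnSampling.stdFeasible A b))
    (hrank : A.rank = m)
    (hc : ColumnSampling.l2norm c = 1)
    (S : ColumnSampling.GroupScheme n nG)
    (C : ℝ) (hC : 0 ≤ C) (δ : ℝ) (hδ : δ ∈ Set.Ioo (0 : ℝ) 1) :
    (∀ γ : ℝ,
      (∀ B : Fin m → Fin n, ColumnSampling.IsBasis A B →
        ColumnSampling.linfNorm (ColumnSampling.dualBasicSol A c B) ≤ γ) →
      1 - δ ≤ (S.sampleLaw nr).real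
        {ω | ColumnSampling.GapBound A b c C S.xi
          (C * (1 + (m : ℝ) * γ * ColumnSampling.maxNorm A) / Real.sqrt (nr : ℝ) *
            (1 + Real.sqrt (2 * Real.log (2 / δ))))
          (ColumnSampling.indices ω)}) ∧
    (∀ χ : ℝ,
      (∀ B : Fin m → Fin n, ColumnSampling.IsBasis A B →
        ColumnSampling.l2norm (ColumnSampling.reducedCost A c B) ≤ χ) →
      1 - δ ≤ (S.sampleLaw nr).real
        {ω | ColumnSampling.GapBound A b c C S.xi
          (C * χ / Real.sqrt (nr : ℝ) * (1 + Real.sqrt (2 * Real.log (1 / δ))))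
          (ColumnSampling.indices ω)}) := by
  open ColumnSampling ColumnSampling.GroupScheme in
  obtain ⟨hδ0, hδ1⟩ := hδ
  -- `‖c‖ = 1` rules out `n = 0`, and any column lies in some group.
  have hG : 0 < nG := by
    rcases Nat.eq_zero_or_pos n with rfl | hn
    · simp [l2norm] at hc
    · exact (S.group ⟨0, hn⟩).pos
  rcases (distrFeasible A b C S.xi).eq_empty_or_nonempty with hemp | hne
  · have hall := fun ε (ω : Fin nr → Fin nG → Fin n) =>
      gapBound_of_distr_infeasible A b c hfeas hbdd C S.xi hemp (indices ω) ε
    simp only [hall, Set.ofPred_true, probReal_univ]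
    exact ⟨fun _ _ => by linarith, fun _ _ => by linarith⟩
  obtain ⟨x, ⟨hAx, hx0, hxC⟩, hopt⟩ := exists_distr_optimal A b c C S.xi hne
  obtain ⟨w, hw, hwC, rfl⟩ := S.exists_density hC hx0 hxC
  have hgap := fun ε (ω : Fin nr → Fin nG → Fin n) =>
    gapBound_of_reducedCost_le A b c hfeas hbdd C S.xi _ hAx hopt (indices ω) (sampleWeight w ω)
      (fun k => mul_nonneg (by positivity) (hw _)) ε
  refine ⟨fun γ hγ => ?_, fun χ hχ => ?_⟩
  -- Each of the two events may fail with probability `δ / 2`, whence `log (2 / δ)`.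
  · have h1 := S.sampleLaw_l2norm_gt_le hnr hG hw hwC (half_pos hδ0) (by linarith)
    have h2 := S.sampleLaw_l2norm_mulVec_gt_le hnr hG A hw hwC (half_pos hδ0) (by linarith)
    rw [one_div_div] at h1 h2
    refine S.one_sub_le_sampleLaw (((measureReal_mono ?_).trans (measureReal_union_le _ _)).trans
      ((add_le_add h1 h2).trans (add_halves δ).le))
    rw [← Set.compl_inter, Set.compl_subset_compl]
    rintro ω ⟨hω1, hω2⟩
    refine hgap _ ω fun B hB =>
      (reducedCost_dotProduct_le_of_linfNorm hc (hγ B hB) hω1 hω2).trans (le_of_eq ?_)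
    -- One `√m` comes from the norm of `p`, the other from the columns of `A`.
    have hm : Real.sqrt m * Real.sqrt m = m := Real.mul_self_sqrt (Nat.cast_nonneg m)
    linear_combination (γ * C * maxNorm A / Real.sqrt nr *
      (1 + Real.sqrt (2 * Real.log (2 / δ)))) * hm
  · have h1 := S.sampleLaw_l2norm_gt_le hnr hG hw hwC hδ0 hδ1.le
    refine S.one_sub_le_sampleLaw ((measureReal_mono ?_).trans h1)
    rw [Set.compl_subset_compl]
    intro ω hω
    refine hgap _ ω fun B hB =>
      (reducedCost_dotProduct_le_of_l2norm (hχ B hB) hω).trans (le_of_eq ?_)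
    ring
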